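/- Let $\alpha>0$ and $T>0$, and let $g\in L^2_{\mathbb C}((0,T),\tau^\alpha\,d\tau)$, i.e. $g$ is measurable, complex-valued and $\int_0^T|g(\tau)|^2\tau^\alpha\,d\tau<\infty$. For $0<t\le T$ and $x>0$ put $$v(x,t)=\mathcal L_t^\alpha g(x):=\frac{(\alpha/2)^\alpha}{\Gamma(\alpha/2)\,t^\alpha}\int_0^t\frac{x}{(t-\tau)^{\alpha/2+1}}\exp\!\left(-\frac{\alpha^2x^{2/\alpha}}{4(t-\tau)}\right)g(\tau)\,\tau^\alpha\,d\tau .$$ Then this integral converges absolutely for all $0<t\le T$ and $x>0$; for each $t\in(0,T]$ the function $$\xi\longmapsto v(\xi,t)\,\xi^{-\frac{(\alpha-1)(\alpha+2)}{2\alpha}}\,e^{\frac{\alpha^2}{4t}\xi^{2/\alpha}}$$ is infinitely differentiable on $(0,\infty)$; and for every $\xi>0$ and every integer $j\ge 0$, $$\lim_{t\to0^+}t^\alpha\left|\partial_\xi^j\left(v(\xi,t)\,\xi^{-\frac{(\alpha-1)(\alpha+2)}{2\alpha}}\,e^{\frac{\alpha^2}{4t}\xi^{2/\alpha}}\right)\right|^2=0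 .$$ -/

import Mathlib

open MeasureTheory Set Filter Topology
open scoped ContDiff

/-- The measure `τ ^ α dτ` on the interval `(0, T)`. -/
noncomputable def powerMeasure (α T : ℝ) : Measure ℝ :=
  (volume.restrict (Ioo 0 T)).withDensity (fun τ => ENNReal.ofReal (τ ^ α))

/-- The integrand
`x / (t - τ) ^ (α / 2 + 1) * exp (- α ^ 2 x ^ (2 / α) / (4 (t - τ))) * g τ * τ ^ α`
of the transform `𝓛_t^α g (x)`. -/
noncomputable def parabolicIntegrand (α t : ℝ) (g : ℝ → ℂ) (x τ : ℝ) : ℂ :=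
  ((x / (t - τ) ^ (α / 2 + 1) *
      Real.exp (-(α ^ 2 * x ^ (2 / α) / (4 * (t - τ)))) : ℝ) : ℂ) * g τ * ((τ ^ α : ℝ) : ℂ)

/-- The transform `𝓛_t^α g (x)`, for `x > 0`. -/
noncomputable def parabolicTransform (α t : ℝ) (g : ℝ → ℂ) (x : ℝ) : ℂ :=
  (((α / 2) ^ α / (Real.Gamma (α / 2) * t ^ α) : ℝ) : ℂ) *
    ∫ τ in Ioo 0 t, parabolicIntegrand α t g x τ

/-- The function `ξ ↦ v(ξ, t) ξ ^ (-(α - 1)(α + 2) / (2 α)) exp (α ^ 2 ξ ^ (2 / α) / (4 t))`, where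
`v(·, t) = 𝓛_t^α g`. -/
noncomputable def normalizedTransform (α t : ℝ) (g : ℝ → ℂ) (ξ : ℝ) : ℂ :=
  parabolicTransform α t g ξ *
    ((ξ ^ (-((α - 1) * (α + 2) / (2 * α))) *
      Real.exp (α ^ 2 / (4 * t) * ξ ^ (2 / α)) : ℝ) : ℂ)

/-! Put s = τ/(t(t-τ)) and y = α²ξ^(2/α)/4. Since 1/(t-τ) = 1/t + s, the kernel's exponential splits
as e^(-y/t) e^(-ys), and the normalization cancels the singular factor e^(-y/t). What remains is a
power of ξ times a Laplace-type integral in y, whose y-derivatives are its moments. By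
Cauchy–Schwarz against τ^(α/2) g, and because ds = dτ/(t-τ)², the k-th moment, prefactor included,
is at most C(k,y) t^(-α/2) (∫₀ᵗ |g|² τ^α dτ)^(1/2) (`norm_smul_transformMoment_le`). The last factor
tends to 0 with t. Each ξ-derivative is a finite combination of moments with coefficients
independent of t, so it inherits the decay (`tendsto_smul_iteratedDeriv_rpow_smul_comp`). -/

/-- The `k`-th derivative in `y` of the Laplace-type integral `∫ exp (-y s(τ)) h(τ) dμ(τ)`. -/
noncomputable def laplaceMoment (μ : Measure ℝ) (s : ℝ → ℝ) (h : ℝ → ℂ) (k : ℕ) (y : ℝ) : ℂ :=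
  ∫ τ, ((-s τ) ^ k * Real.exp (-(y * s τ))) • h τ ∂μ

/-- As s ≥ 0, the next moment's integrand at y/2 dominates in norm for all z > y/2. -/
theorem hasDerivAt_laplaceMoment {μ : Measure ℝ} {s : ℝ → ℝ} {h : ℝ → ℂ}
    (hs : ∀ᵐ τ ∂μ, 0 ≤ s τ)
    (hint : ∀ (k : ℕ) (y : ℝ), 0 < y →
      Integrable (fun τ => ((-s τ) ^ k * Real.exp (-(y * s τ))) • h τ) μ)
    (k : ℕ) {y : ℝ} (hy : 0 < y) :
    HasDerivAt (laplaceMoment μ s h k) (laplaceMoment μ s h (k + 1) y) y := by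
  unfold laplaceMoment
  have hnhds : Ioi (y / 2) ∈ 𝓝 y := Ioi_mem_nhds (by linarith)
  refine (hasDerivAt_integral_of_dominated_loc_of_deriv_le (μ := μ)
    (F := fun y τ => ((-s τ) ^ k * Real.exp (-(y * s τ))) • h τ)
    (F' := fun y τ => ((-s τ) ^ (k + 1) * Real.exp (-(y * s τ))) • h τ)
    (bound := fun τ => ‖((-s τ) ^ (k + 1) * Real.exp (-(y / 2 * s τ))) • h τ‖)
    hnhds ?_ (hint k y hy) (hint (k + 1) y hy).1 ?_
    (hint (k + 1) (y / 2) (by linarith)).norm ?_).2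
  · filter_upwards [Ioi_mem_nhds hy] with z hz using (hint k z hz).1
  · filter_upwards [hs] with τ hτ z hz
    rw [norm_smul, norm_smul, norm_mul, norm_mul, Real.norm_of_nonneg (Real.exp_nonneg _),
      Real.norm_of_nonneg (Real.exp_nonneg _)]
    have : y / 2 * s τ ≤ z * s τ := mul_le_mul_of_nonneg_right (le_of_lt hz) hτ
    gcongr
  · refine Eventually.of_forall fun τ z _ => ?_
    have h1 : HasDerivAt (fun z : ℝ => -(z * s τ)) (-(1 * s τ)) z :=
      ((hasDerivAt_id z).mul_const (s τ)).neg
    have h2 := ((h1.exp).const_mul ((-s τ) ^ k)).smul_const (h τ)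
    convert h2 using 2
    ring

/-! ### Derivatives after the substitution y = c x^r -/

section RpowComp

variable {c r : ℝ}

/-- The family x^q F_k(c x^r) spans a space closed under differentiation, so inductions over general
k and q replace an explicit higher chain rule. -/
theorem hasDerivAt_rpow_smul_comp {F : ℕ → ℝ → ℂ} (hc : 0 < c)
    (hF : ∀ (k : ℕ) (y : ℝ), 0 < y → HasDerivAt (F k) (F (k + 1) y) y)
    (k : ℕ) (q : ℝ) {x : ℝ} (hx : 0 < x) :
    HasDerivAt (fun x : ℝ => x ^ q • F k (c * x ^ r))
      (q • (x ^ (q - 1) • F k (c * x ^ r)) +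
        (c * r) • (x ^ (q + (r - 1)) • F (k + 1) (c * x ^ r))) x := by
  have h1 : HasDerivAt (fun x : ℝ => x ^ q) (q * x ^ (q - 1)) x :=
    Real.hasDerivAt_rpow_const (Or.inl hx.ne')
  have h2 : HasDerivAt (fun x : ℝ => c * x ^ r) (c * (r * x ^ (r - 1))) x :=
    (Real.hasDerivAt_rpow_const (Or.inl hx.ne')).const_mul c
  have hy : 0 < c * x ^ r := mul_pos hc (Real.rpow_pos_of_pos hx r)
  have h3 := h1.smul ((hF k _ hy).scomp x h2)
  refine h3.congr_deriv ?_
  rw [Real.rpow_add hx]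
  simp only [Function.comp, smul_smul]
  rw [add_comm]
  congr 2
  ring

theorem contDiffOn_rpow_smul_comp {F : ℕ → ℝ → ℂ} (hc : 0 < c)
    (hF : ∀ (k : ℕ) (y : ℝ), 0 < y → HasDerivAt (F k) (F (k + 1) y) y) (k : ℕ) (q : ℝ) :
    ContDiffOn ℝ ∞ (fun x : ℝ => x ^ q • F k (c * x ^ r)) (Ioi 0) := by
  rw [contDiffOn_infty]
  intro n
  induction n generalizing k q with
  | zero =>
    rw [Nat.cast_zero, contDiffOn_zero]
    exact fun x hx => (hasDerivAt_rpow_smul_comp hc hF k q hx).continuousAt.continuousWithinAt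
  | succ n ih =>
    rw [Nat.cast_succ, contDiffOn_succ_iff_deriv_of_isOpen isOpen_Ioi]
    refine ⟨fun x hx =>
      (hasDerivAt_rpow_smul_comp hc hF k q hx).differentiableAt.differentiableWithinAt,
      by simp, ?_⟩
    exact (((ih k (q - 1)).const_smul q).add
      ((ih (k + 1) (q + (r - 1))).const_smul (c * r))).congr
      fun x hx => (hasDerivAt_rpow_smul_comp hc hF k q hx).deriv

theorem tendsto_smul_iteratedDeriv_rpow_smul_comp {ι : Type*} {l : Filter ι} {w : ι → ℝ}
    {F : ι → ℕ → ℝ → ℂ} (hc : 0 < c)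
    (hF : ∀ᶠ t in l, ∀ (k : ℕ) (y : ℝ), 0 < y → HasDerivAt (F t k) (F t (k + 1) y) y)
    (hlim : ∀ (k : ℕ) (y : ℝ), 0 < y → Tendsto (fun t => w t • F t k y) l (𝓝 0))
    {x : ℝ} (hx : 0 < x) (j k : ℕ) (q : ℝ) :
    Tendsto (fun t => w t • iteratedDeriv j (fun x : ℝ => x ^ q • F t k (c * x ^ r)) x) l
      (𝓝 0) := by
  induction j generalizing k q with
  | zero =>
    have := (hlim k (c * x ^ r) (mul_pos hc (Real.rpow_pos_of_pos hx r))).const_smul (x ^ q)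
    rw [smul_zero] at this
    refine this.congr fun t => ?_
    rw [iteratedDeriv_zero, smul_comm]
  | succ j ih =>
    have := ((ih k (q - 1)).const_smul q).add ((ih (k + 1) (q + (r - 1))).const_smul (c * r))
    rw [smul_zero, smul_zero, add_zero] at this
    refine this.congr' ?_
    filter_upwards [hF] with t ht
    have hd : deriv (fun x : ℝ => x ^ q • F t k (c * x ^ r)) =ᶠ[𝓝 x]
        (q • fun x : ℝ => x ^ (q - 1) • F t k (c * x ^ r)) +
        (c * r) • fun x : ℝ => x ^ (q + (r - 1)) • F t (k + 1) (c * x ^ r) := by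
      filter_upwards [Ioi_mem_nhds hx] with z hz
        using (hasDerivAt_rpow_smul_comp hc ht k q hz).deriv
    have hsm : ∀ (k : ℕ) (q : ℝ), ContDiffAt ℝ j (fun x : ℝ => x ^ q • F t k (c * x ^ r)) x :=
      fun k q => ((contDiffOn_rpow_smul_comp hc ht k q).contDiffAt (Ioi_mem_nhds hx)).of_le

        (by exact_mod_cast (WithTop.coe_le_coe.2 le_top : ((j : ℕ∞) : WithTop ℕ∞) ≤ ∞))
    have hsum := iteratedDeriv_add (f := q • fun x : ℝ => x ^ (q - 1) • F t k (c * x ^ r))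
      (g := (c * r) • fun x : ℝ => x ^ (q + (r - 1)) • F t (k + 1) (c * x ^ r))
      ((hsm k (q - 1)).const_smul q) ((hsm (k + 1) (q + (r - 1))).const_smul (c * r))
    rw [iteratedDeriv_succ', hd.iteratedDeriv_eq, hsum,
      iteratedDeriv_const_smul_field, iteratedDeriv_const_smul_field, smul_add,
      smul_comm (w t) q, smul_comm (w t) (c * r)]

end RpowComp

/-! ### Weighted L² estimates -/

theorem memLp_rpow_smul_of_powerMeasure {α T t : ℝ} {g : ℝ → ℂ} (ht : t ≤ T)
    (hg : MemLp g 2 (powerMeasure α T)) :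
    MemLp (fun τ => τ ^ (α / 2) • g τ) 2 (volume.restrict (Ioo 0 t)) := by
  have hmeas : Measurable fun τ : ℝ => ENNReal.ofReal (τ ^ α) := by fun_prop
  -- The density τ^α is positive on (0,T), so measurability of g passes back to Lebesgue measure.
  have hac : volume.restrict (Ioo 0 T) ≪ powerMeasure α T := by
    refine withDensity_absolutelyContinuous' hmeas.aemeasurable ?_
    filter_upwards [ae_restrict_mem measurableSet_Ioo] with τ hτ
    simpa using Real.rpow_pos_of_pos hτ.1 α
  have hg0 : AEStronglyMeasurable g (volume.restrict (Ioo 0 T)) := hg.1.mono_ac hac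
  have hm : AEStronglyMeasurable (fun τ => τ ^ (α / 2) • g τ) (volume.restrict (Ioo 0 T)) :=
    (by fun_prop : Measurable fun τ : ℝ => τ ^ (α / 2)).aestronglyMeasurable.smul hg0
  refine MemLp.mono_measure (Measure.restrict_mono (Ioo_subset_Ioo_right ht) le_rfl) ?_
  rw [memLp_two_iff_integrable_sq_norm hm]
  have h2 := (memLp_two_iff_integrable_sq_norm hg.1).1 hg
  rw [powerMeasure, integrable_withDensity_iff_integrable_smul' hmeas (by simp)] at h2
  refine h2.congr ?_
  filter_upwards [ae_restrict_mem measurableSet_Ioo] with τ hτ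
  rw [ENNReal.toReal_ofReal (Real.rpow_nonneg hτ.1.le _), norm_smul, mul_pow,
    Real.norm_of_nonneg (Real.rpow_nonneg hτ.1.le _), ← Real.rpow_natCast (τ ^ (α / 2)) 2,
    ← Real.rpow_mul hτ.1.le, smul_eq_mul]
  norm_num

theorem norm_integral_smul_le_sqrt_mul_sqrt {X : Type*} [MeasurableSpace X] {μ : Measure X}
    {f : X → ℝ} {u : X → ℂ} (hf : MemLp f 2 μ) (hu : MemLp u 2 μ) :
    ‖∫ x, f x • u x ∂μ‖ ≤ √(∫ x, f x ^ 2 ∂μ) * √(∫ x, ‖u x‖ ^ 2 ∂μ) := by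
  refine (norm_integral_le_integral_norm _).trans ?_
  have := integral_mul_norm_le_Lp_mul_Lq (μ := μ) (f := f) (g := fun x => ‖u x‖)
    Real.HolderConjugate.two_two (by simpa using hf) (by simpa using hu.norm)
  simpa [norm_smul, Real.sqrt_eq_rpow] using this

/-- The weight multiplying `τ ^ (α / 2) g(τ)` in the `k`-th moment, up to sign. -/
noncomputable def momentWeight (α t y : ℝ) (k : ℕ) (τ : ℝ) : ℝ :=
  (-(τ / (t * (t - τ)))) ^ k * Real.exp (-(y * (τ / (t * (t - τ))))) *
    ((t - τ) ^ (-(α / 2 + 1)) * τ ^ (α / 2))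

/-- The factor 1/(t-τ)² is the Jacobian ds/dτ; the rest becomes a function of s alone, up to t^α. -/
theorem sq_momentWeight {α t y τ : ℝ} (k : ℕ) (hτ : τ ∈ Ioo 0 t) :
    momentWeight α t y k τ ^ 2 = t ^ α * (|1 / (t - τ) ^ 2| •
      ((τ / (t * (t - τ))) ^ (2 * (k : ℝ) + α) *
        Real.exp (-(2 * y) * (τ / (t * (t - τ)))))) := by
  have h0 : 0 < τ := hτ.1
  have h1 : 0 < t - τ := sub_pos.2 hτ.2
  have ht : 0 < t := h0.trans hτ.2
  have hs : 0 < τ / (t * (t - τ)) := by positivity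
  have e1 : ((t - τ) ^ (-(α / 2 + 1))) ^ 2 = (t - τ) ^ (-α) * (1 / (t - τ) ^ 2) := by
    rw [← Real.rpow_natCast, ← Real.rpow_mul h1.le, one_div, ← Real.rpow_natCast (t - τ) 2,
      ← Real.rpow_neg h1.le, ← Real.rpow_add h1]
    congr 1; push_cast; ring
  have e2 : (τ ^ (α / 2)) ^ 2 = τ ^ α := by
    rw [← Real.rpow_natCast, ← Real.rpow_mul h0.le]
    congr 1; push_cast; ring
  have e3 : (τ / (t * (t - τ))) ^ (2 * (k : ℝ) + α) =
      (τ / (t * (t - τ))) ^ (2 * k) * (τ ^ α * (t ^ (-α) * (t - τ) ^ (-α))) := by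
    rw [Real.rpow_add hs, Real.div_rpow h0.le (by positivity) α, Real.mul_rpow ht.le h1.le,
      Real.rpow_neg ht.le, Real.rpow_neg h1.le, ← mul_inv, div_eq_mul_inv (τ ^ α)]
    congr 1
    rw [← Real.rpow_natCast]; push_cast; rfl
  have e4 : t ^ α * t ^ (-α) = 1 := by rw [← Real.rpow_add ht]; simp
  have e5 : Real.exp (-(y * (τ / (t * (t - τ))))) ^ 2 =
      Real.exp (-(2 * y) * (τ / (t * (t - τ)))) := by
    rw [← Real.exp_nat_mul]; congr 1; push_cast; ring
  have e6 : ((-(τ / (t * (t - τ)))) ^ k) ^ 2 = (τ / (t * (t - τ))) ^ (2 * k) := by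
    rw [← pow_mul, mul_comm k 2, pow_mul, neg_sq, ← pow_mul]
  rw [momentWeight, abs_of_nonneg (by positivity), mul_pow, mul_pow, mul_pow, e1, e2, e3, e5, e6,
    smul_eq_mul]
  linear_combination (-(τ / (t * (t - τ))) ^ (2 * k) *
    Real.exp (-(2 * y) * (τ / (t * (t - τ)))) * ((t - τ) ^ (-α) * (1 / (t - τ) ^ 2)) * τ ^ α) * e4

theorem integrableOn_rpow_mul_exp {α y : ℝ} (hα : 0 < α) (hy : 0 < y) (k : ℕ) :
    IntegrableOn (fun s : ℝ => s ^ (2 * (k : ℝ) + α) * Real.exp (-(2 * y) * s)) (Ioi 0) := by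
  have hk : (0 : ℝ) ≤ k := k.cast_nonneg
  simpa using integrableOn_rpow_mul_exp_neg_mul_rpow (s := 2 * (k : ℝ) + α) (p := 1) (b := 2 * y)
    (by linarith) one_pos (by linarith)

/-- Substituting s = τ/(t(t-τ)) gives a Gamma-type integral not involving t; the image lying in
(0,∞) suffices for the bound. -/
theorem memLp_momentWeight_and_integral_sq_le {α t y : ℝ} (hα : 0 < α) (ht : 0 < t) (hy : 0 < y)
    (k : ℕ) :
    MemLp (momentWeight α t y k) 2 (volume.restrict (Ioo 0 t)) ∧
    ∫ τ in Ioo 0 t, momentWeight α t y k τ ^ 2 ≤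
      t ^ α * ∫ s in Ioi 0, s ^ (2 * (k : ℝ) + α) * Real.exp (-(2 * y) * s) := by
  have hder : ∀ τ ∈ Ioo 0 t, HasDerivWithinAt (fun τ => τ / (t * (t - τ))) (1 / (t - τ) ^ 2)
      (Ioo 0 t) τ := by
    intro τ hτ
    have h1 : t - τ ≠ 0 := (sub_pos.2 hτ.2).ne'
    have h2 : HasDerivAt (fun τ => t * (t - τ)) (t * (-1)) τ :=
      ((hasDerivAt_id τ).const_sub t).const_mul t
    refine (((hasDerivAt_id τ).div h2 (mul_ne_zero ht.ne' h1)).congr_deriv ?_).hasDerivWithinAt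
    simp only [id]
    field_simp
    ring
  have hinj : InjOn (fun τ => τ / (t * (t - τ))) (Ioo 0 t) := by
    intro a ha b hb hab
    have h1 : t - a ≠ 0 := (sub_pos.2 ha.2).ne'
    have h2 : t - b ≠ 0 := (sub_pos.2 hb.2).ne'
    have h3 := ht.ne'
    simp only at hab
    field_simp at hab
    have : t * (a - b) = 0 := by linear_combination hab
    rcases mul_eq_zero.1 this with h | h
    · exact absurd h h3
    · linarith
  have himg : (fun τ => τ / (t * (t - τ))) '' Ioo 0 t ⊆ Ioi 0 := by
    rintro _ ⟨τ, hτ, rfl⟩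
    exact div_pos hτ.1 (mul_pos ht (sub_pos.2 hτ.2))
  have hI := integrableOn_rpow_mul_exp hα hy k
  have hI2 := (integrableOn_image_iff_integrableOn_abs_deriv_smul measurableSet_Ioo hder hinj
    (fun s : ℝ => s ^ (2 * (k : ℝ) + α) * Real.exp (-(2 * y) * s))).1 (hI.mono_set himg)
  have hE := integral_image_eq_integral_abs_deriv_smul measurableSet_Ioo hder hinj
    (fun s : ℝ => s ^ (2 * (k : ℝ) + α) * Real.exp (-(2 * y) * s))
  constructor
  · have hm : Measurable (momentWeight α t y k) := by unfold momentWeight; fun_prop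
    rw [memLp_two_iff_integrable_sq hm.aestronglyMeasurable]
    refine (hI2.const_mul (t ^ α)).congr ?_
    filter_upwards [ae_restrict_mem measurableSet_Ioo] with τ hτ using (sq_momentWeight k hτ).symm
  · rw [setIntegral_congr_fun measurableSet_Ioo fun τ hτ => sq_momentWeight k hτ,
      integral_const_mul, ← hE]
    refine mul_le_mul_of_nonneg_left (setIntegral_mono_set hI ?_ himg.eventuallyLE)
      (Real.rpow_nonneg ht.le _)
    filter_upwards [ae_restrict_mem measurableSet_Ioi] with s hs
    exact mul_nonneg (Real.rpow_nonneg (le_of_lt hs) _) (Real.exp_nonneg _)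

/-! ### Laplace representation of the transform -/

/-- The density `(t - τ) ^ (-(α / 2 + 1)) τ ^ α g(τ)` of the Laplace-type representation. -/
noncomputable def momentDensity (α t : ℝ) (g : ℝ → ℂ) (τ : ℝ) : ℂ :=
  ((t - τ) ^ (-(α / 2 + 1)) * τ ^ α) • g τ

theorem moment_smul_density_eq {α t y τ : ℝ} (g : ℝ → ℂ) (k : ℕ) (hτ : 0 < τ) :
    ((-(τ / (t * (t - τ)))) ^ k * Real.exp (-(y * (τ / (t * (t - τ)))))) • momentDensity α t g τ =
      momentWeight α t y k τ • (τ ^ (α / 2) • g τ) := by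
  have : τ ^ α = τ ^ (α / 2) * τ ^ (α / 2) := by rw [← Real.rpow_add hτ]; congr 1; ring
  rw [momentDensity, momentWeight, smul_smul, smul_smul, this]
  congr 1
  ring

/-- The `k`-th moment of the transform at time `t`, as a function of `y = α ^ 2 ξ ^ (2 / α) / 4`. -/
noncomputable def transformMoment (α t : ℝ) (g : ℝ → ℂ) (k : ℕ) (y : ℝ) : ℂ :=
  ((α / 2) ^ α / (Real.Gamma (α / 2) * t ^ α)) •
    laplaceMoment (volume.restrict (Ioo 0 t)) (fun τ => τ / (t * (t - τ))) (momentDensity α t g) k y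

section Transform

variable {α T t : ℝ} {g : ℝ → ℂ}

theorem integrable_moment_smul_density (hα : 0 < α) (ht : t ∈ Ioc 0 T)
    (hg : MemLp g 2 (powerMeasure α T)) (k : ℕ) (y : ℝ) (hy : 0 < y) :
    Integrable (fun τ => ((-(τ / (t * (t - τ)))) ^ k * Real.exp (-(y * (τ / (t * (t - τ)))))) •
      momentDensity α t g τ) (volume.restrict (Ioo 0 t)) := by
  have h2 := memLp_one_iff_integrable.1 ((memLp_rpow_smul_of_powerMeasure ht.2 hg).smul
    (memLp_momentWeight_and_integral_sq_le hα ht.1 hy k).1 (r := 1))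
  refine h2.congr ?_
  filter_upwards [ae_restrict_mem measurableSet_Ioo] with τ hτ
    using (moment_smul_density_eq g k hτ.1).symm

theorem hasDerivAt_transformMoment (hα : 0 < α) (ht : t ∈ Ioc 0 T)
    (hg : MemLp g 2 (powerMeasure α T)) (k : ℕ) (y : ℝ) (hy : 0 < y) :
    HasDerivAt (transformMoment α t g k) (transformMoment α t g (k + 1) y) y := by
  refine HasDerivAt.const_smul ((α / 2) ^ α / (Real.Gamma (α / 2) * t ^ α))
    (hasDerivAt_laplaceMoment ?_ (integrable_moment_smul_density hα ht hg) k hy)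
  filter_upwards [ae_restrict_mem measurableSet_Ioo] with τ hτ
  exact div_nonneg hτ.1.le (mul_nonneg ht.1.le (sub_nonneg.2 hτ.2.le))

/-- The powers of t cancel exactly: t^(-α) from the prefactor, t^(α/2) from the weight's L² norm,
t^(α/2) from the normalization. -/
theorem norm_smul_transformMoment_le (hα : 0 < α) (ht : t ∈ Ioc 0 T)
    (hg : MemLp g 2 (powerMeasure α T)) (k : ℕ) {y : ℝ} (hy : 0 < y) :
    ‖t ^ (α / 2) • transformMoment α t g k y‖ ≤
      (α / 2) ^ α / Real.Gamma (α / 2) *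
        √(∫ s in Ioi 0, s ^ (2 * (k : ℝ) + α) * Real.exp (-(2 * y) * s)) *
        √(∫ τ in Ioo 0 t, ‖τ ^ (α / 2) • g τ‖ ^ 2) := by
  obtain ⟨hm, hle⟩ := memLp_momentWeight_and_integral_sq_le hα ht.1 hy k
  have hG : 0 < Real.Gamma (α / 2) := Real.Gamma_pos_of_pos (by linarith)
  have htp : 0 < t ^ (α / 2) := Real.rpow_pos_of_pos ht.1 _
  have htα : 0 < t ^ α := Real.rpow_pos_of_pos ht.1 _
  have hsqrt : √(t ^ α) = t ^ (α / 2) := by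
    rw [Real.sqrt_eq_rpow, ← Real.rpow_mul ht.1.le]
    congr 1; ring
  have hA : 0 < (α / 2) ^ α := Real.rpow_pos_of_pos (by linarith) _
  have hsq : t ^ (α / 2) * t ^ (α / 2) = t ^ α := by
    rw [← Real.rpow_add ht.1]; congr 1; ring
  have hlap : ‖laplaceMoment (volume.restrict (Ioo 0 t)) (fun τ => τ / (t * (t - τ)))
      (momentDensity α t g) k y‖ ≤
      t ^ (α / 2) * √(∫ s in Ioi 0, s ^ (2 * (k : ℝ) + α) * Real.exp (-(2 * y) * s)) *
        √(∫ τ in Ioo 0 t, ‖τ ^ (α / 2) • g τ‖ ^ 2) := by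
    rw [laplaceMoment, setIntegral_congr_fun measurableSet_Ioo
      fun τ hτ => moment_smul_density_eq g k hτ.1]
    refine (norm_integral_smul_le_sqrt_mul_sqrt hm
      (memLp_rpow_smul_of_powerMeasure ht.2 hg)).trans ?_
    refine mul_le_mul_of_nonneg_right ?_ (Real.sqrt_nonneg _)
    rw [← hsqrt, ← Real.sqrt_mul htα.le]
    exact Real.sqrt_le_sqrt hle
  rw [transformMoment, smul_smul, norm_smul, Real.norm_of_nonneg (by positivity)]
  refine (mul_le_mul_of_nonneg_left hlap (by positivity)).trans (le_of_eq ?_)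
  rw [← hsq]
  field_simp

theorem parabolicIntegrand_eq (g : ℝ → ℂ) (x : ℝ) {τ : ℝ} (hτ : τ ∈ Ioo 0 t) :
    parabolicIntegrand α t g x τ = (x * Real.exp (-(α ^ 2 / (4 * t) * x ^ (2 / α)))) •
      (((-(τ / (t * (t - τ)))) ^ 0 *
        Real.exp (-(α ^ 2 / 4 * x ^ (2 / α) * (τ / (t * (t - τ)))))) • momentDensity α t g τ) := by
  have h1 : 0 < t - τ := sub_pos.2 hτ.2
  have ht : 0 < t := hτ.1.trans hτ.2
  -- This is 1/(t-τ) = 1/t + τ/(t(t-τ)).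
  have he : Real.exp (-(α ^ 2 * x ^ (2 / α) / (4 * (t - τ)))) =
      Real.exp (-(α ^ 2 / (4 * t) * x ^ (2 / α))) *
        Real.exp (-(α ^ 2 / 4 * x ^ (2 / α) * (τ / (t * (t - τ))))) := by
    rw [← Real.exp_add]
    congr 1
    field_simp
    ring
  rw [parabolicIntegrand, momentDensity, he, Real.rpow_neg h1.le, smul_smul, smul_smul,
    Complex.real_smul]
  push_cast
  ring

theorem integrableOn_parabolicIntegrand (hα : 0 < α) (ht : t ∈ Ioc 0 T)
    (hg : MemLp g 2 (powerMeasure α T)) {x : ℝ} (hx : 0 < x) :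
    IntegrableOn (parabolicIntegrand α t g x) (Ioo 0 t) := by
  have hy : 0 < α ^ 2 / 4 * x ^ (2 / α) := by positivity
  have h := (integrable_moment_smul_density hα ht hg 0 _ hy).smul
    (x * Real.exp (-(α ^ 2 / (4 * t) * x ^ (2 / α))))
  refine h.congr ?_
  filter_upwards [ae_restrict_mem measurableSet_Ioo] with τ hτ
    using (parabolicIntegrand_eq g x hτ).symm

theorem normalizedTransform_eq (g : ℝ → ℂ) {x : ℝ} (hx : 0 < x) :
    normalizedTransform α t g x = x ^ (1 + -((α - 1) * (α + 2) / (2 * α))) •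
      transformMoment α t g 0 (α ^ 2 / 4 * x ^ (2 / α)) := by
  have he : Real.exp (-(α ^ 2 / (4 * t) * x ^ (2 / α))) *
      Real.exp (α ^ 2 / (4 * t) * x ^ (2 / α)) = 1 := by
    rw [← Real.exp_add, neg_add_cancel, Real.exp_zero]
  have heC := congrArg Complex.ofReal he
  rw [normalizedTransform, parabolicTransform, setIntegral_congr_fun measurableSet_Ioo
    fun τ hτ => parabolicIntegrand_eq g x hτ, integral_smul, Real.rpow_add hx, Real.rpow_one,
    transformMoment, ← laplaceMoment]
  simp only [Complex.real_smul, Complex.ofReal_mul, Complex.ofReal_one] at heC ⊢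
  linear_combination (((α / 2) ^ α / (Real.Gamma (α / 2) * t ^ α) : ℝ) : ℂ) *
    laplaceMoment (volume.restrict (Ioo 0 t)) (fun τ => τ / (t * (t - τ))) (momentDensity α t g) 0
      (α ^ 2 / 4 * x ^ (2 / α)) * (x : ℂ) *
    ((x ^ (-((α - 1) * (α + 2) / (2 * α))) : ℝ) : ℂ) * heC

theorem contDiffOn_normalizedTransform (hα : 0 < α) (ht : t ∈ Ioc 0 T)
    (hg : MemLp g 2 (powerMeasure α T)) :
    ContDiffOn ℝ ∞ (normalizedTransform α t g) (Ioi 0) :=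
  (contDiffOn_rpow_smul_comp (by positivity) (hasDerivAt_transformMoment hα ht hg) 0 _).congr
    fun _ hx => normalizedTransform_eq g hx

theorem tendsto_smul_transformMoment (hα : 0 < α) (hT : 0 < T)
    (hg : MemLp g 2 (powerMeasure α T)) (k : ℕ) (y : ℝ) (hy : 0 < y) :
    Tendsto (fun t : ℝ => t ^ (α / 2) • transformMoment α t g k y) (𝓝[>] 0) (𝓝 0) := by
  have hu := memLp_rpow_smul_of_powerMeasure le_rfl hg
  have hlim : Tendsto (fun t : ℝ => ∫ τ in Ioo 0 t, ‖τ ^ (α / 2) • g τ‖ ^ 2) (𝓝[>] 0) (𝓝 0) := by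
    have h0 : Tendsto (fun t : ℝ => volume.restrict (Ioo 0 T) (Ioo 0 t)) (𝓝[>] 0) (𝓝 0) := by
      have h1 : Tendsto (fun t : ℝ => ENNReal.ofReal t) (𝓝[>] 0) (𝓝 0) := by
        simpa using (ENNReal.continuous_ofReal.tendsto 0).mono_left nhdsWithin_le_nhds
      refine tendsto_of_tendsto_of_tendsto_of_le_of_le tendsto_const_nhds h1
        (fun _ => zero_le) fun t => ?_
      exact (Measure.restrict_apply_le _ _).trans (by simp)
    -- Absolute continuity of the integral: (0,t) has measure tending to 0.
    refine (HasFiniteIntegral.tendsto_setIntegral_nhds_zero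
      ((memLp_two_iff_integrable_sq_norm hu.1).1 hu).2 h0).congr' ?_
    filter_upwards [Ioc_mem_nhdsGT hT] with t ht
    rw [Measure.restrict_restrict measurableSet_Ioo,
      inter_eq_left.2 (Ioo_subset_Ioo_right ht.2)]
  refine squeeze_zero_norm' ?_ (a := fun t : ℝ => (α / 2) ^ α / Real.Gamma (α / 2) *
    √(∫ s in Ioi 0, s ^ (2 * (k : ℝ) + α) * Real.exp (-(2 * y) * s)) *
    √(∫ τ in Ioo 0 t, ‖τ ^ (α / 2) • g τ‖ ^ 2)) ?_
  · filter_upwards [Ioc_mem_nhdsGT hT] with t ht using norm_smul_transformMoment_le hα ht hg k hy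
  · simpa using hlim.sqrt.const_mul ((α / 2) ^ α / Real.Gamma (α / 2) *
      √(∫ s in Ioi 0, s ^ (2 * (k : ℝ) + α) * Real.exp (-(2 * y) * s)))

end Transform

theorem mainTheorem5 (α T : ℝ) (hα : 0 < α) (hT : 0 < T) (g : ℝ → ℂ)
    (hg : MemLp g 2 (powerMeasure α T)) :
    (∀ t ∈ Ioc 0 T, ∀ x : ℝ, 0 < x → IntegrableOn (parabolicIntegrand α t g x) (Ioo 0 t)) ∧
    (∀ t ∈ Ioc 0 T, ContDiffOn ℝ ∞ (normalizedTransform α t g) (Ioi 0)) ∧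
    (∀ ξ : ℝ, 0 < ξ → ∀ j : ℕ,
      Tendsto (fun t : ℝ => t ^ α * ‖iteratedDeriv j (normalizedTransform α t g) ξ‖ ^ 2)
        (𝓝[>] 0) (𝓝 0)) := by
  refine ⟨fun t ht x hx => integrableOn_parabolicIntegrand hα ht hg hx,
    fun t ht => contDiffOn_normalizedTransform hα ht hg, fun ξ hξ j => ?_⟩
  have hF : ∀ᶠ t in 𝓝[>] (0 : ℝ), ∀ (k : ℕ) (y : ℝ), 0 < y →
      HasDerivAt (transformMoment α t g k) (transformMoment α t g (k + 1) y) y := by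
    filter_upwards [Ioc_mem_nhdsGT hT] with t ht using hasDerivAt_transformMoment hα ht hg
  have h := ((tendsto_smul_iteratedDeriv_rpow_smul_comp (c := α ^ 2 / 4) (r := 2 / α)
    (by positivity) hF (tendsto_smul_transformMoment hα hT hg) hξ j 0
    (1 + -((α - 1) * (α + 2) / (2 * α)))).norm).pow 2
  rw [norm_zero, zero_pow two_ne_zero] at h
  refine h.congr' ?_
  filter_upwards [self_mem_nhdsWithin] with t ht
  have ht0 : 0 ≤ t := le_of_lt ht
  -- The representation holds only for x > 0, so derivatives are compared through germs at ξ.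
  have hEq : normalizedTransform α t g =ᶠ[𝓝 ξ] fun x =>
      x ^ (1 + -((α - 1) * (α + 2) / (2 * α))) •
        transformMoment α t g 0 (α ^ 2 / 4 * x ^ (2 / α)) := by
    filter_upwards [Ioi_mem_nhds hξ] with x hx using normalizedTransform_eq g hx
  rw [hEq.iteratedDeriv_eq, norm_smul, mul_pow, Real.norm_of_nonneg (Real.rpow_nonneg ht0 _),
    ← Real.rpow_natCast (t ^ (α / 2)) 2, ← Real.rpow_mul ht0]
  norm_num
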